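/- Let $n \ge 0$ and $d \ge 1$ be integers, let $R=\mathbb{C}[x_0,\dots,x_n]$ with its usual grading, and let $Q=\mathbb{C}[X_0,\dots,X_n]$ act on $R$ by $X_i=\partial/\partial x_i$. For $f\in R_d$ put $\operatorname{Ann}(f)=\{\alpha\in Q : \alpha(f)=0\}$, $A(f)=Q/\operatorname{Ann}(f)$, let $A(f)_k$ be the image of $Q_k$ in $A(f)$, and let $h_k(A(f))=\dim_{\mathbb{C}}A(f)_k$. There is a nonempty Zariski open subset $U'_d$ of the affine space $R_d$ on which the Hilbert vector $(h_0(A(f)),\dots,h_d(A(f)))$ is constant. For every such $U'_d$ and every $f\in U'_d$ one has $$h_k(A(f))=\dim_{\mathbb{C}} Q_k=\binom{n+k}{n}\quad\text{for } 0\le k\le d/2,$$ $$h_k(A(f))=h_{d-k}(A(f))=\binom{n+d-k}{n}\quad\text{for } d/2<k\le d.$$ In particular, if $n\ge 1$ and $d\ge 4$, then the Fermat polynomial $x_0^d+\dots+x_n^d$ does not belong to any such $U'_d$. -/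

import Mathlib

noncomputable section

namespace MacaulayDual

/-- `Poly n` is the ring of complex polynomials in the `n + 1` variables of index `0, …, n`.
It plays two roles: as `R = ℂ[x₀, …, xₙ]` and as the ring `Q = ℂ[X₀, …, Xₙ]` of constant-coefficient
differential operators on `R`. -/
abbrev Poly (n : ℕ) : Type := MvPolynomial (Fin (n + 1)) ℂ

/-- The space of homogeneous polynomials of degree `d` (that is `R_d`, and also `Q_d`). -/
abbrev Form (n d : ℕ) : Submodule ℂ (Poly n) :=
  MvPolynomial.homogeneousSubmodule (Fin (n + 1)) ℂ d

/-- The partial derivative with respect to `x_i`, as a linear endomorphism of `R`. -/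
def partialD (n : ℕ) (i : Fin (n + 1)) : Module.End ℂ (Poly n) :=
  (MvPolynomial.pderiv i : Derivation ℂ (Poly n) (Poly n)).toLinearMap

theorem partialD_comm (n : ℕ) (i j : Fin (n + 1)) :
    partialD n i * partialD n j = partialD n j * partialD n i := by
  have h : ⁅(MvPolynomial.pderiv i : Derivation ℂ (Poly n) (Poly n)),
      (MvPolynomial.pderiv j : Derivation ℂ (Poly n) (Poly n))⁆ = 0 := by
    apply MvPolynomial.derivation_ext
    intro k
    simp only [Derivation.commutator_apply, MvPolynomial.pderiv_X, Derivation.zero_apply]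
    by_cases hi : i = k <;> by_cases hj : j = k <;> simp [hi, hj]
  refine LinearMap.ext fun f => ?_
  have := congrArg (fun D => D f) h
  simpa [partialD, Derivation.commutator_apply, sub_eq_zero] using this

/-- The commutative algebra of differential operators generated by the partial derivatives. -/
abbrev DiffAlg (n : ℕ) : Subalgebra ℂ (Module.End ℂ (Poly n)) :=
  Algebra.adjoin ℂ (Set.range (partialD n))

instance diffAlgCommRing (n : ℕ) : CommRing (DiffAlg n) where
  __ := (inferInstance : Ring (DiffAlg n))
  mul_comm := by
    have := Algebra.isMulCommutative_adjoin ℂ (s := Set.range (partialD n)) (by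
      rintro _ ⟨i, rfl⟩ _ ⟨j, rfl⟩
      exact partialD_comm n i j)
    exact this.is_comm.comm

/-- The action of `Q` on `R`: the algebra homomorphism from `Q` to the linear endomorphisms of `R`
which sends `X_i` to `∂/∂x_i`. -/
def diffOp (n : ℕ) : Poly n →ₐ[ℂ] Module.End ℂ (Poly n) :=
  (DiffAlg n).val.comp
    (MvPolynomial.aeval fun i => (⟨partialD n i, Algebra.subset_adjoin ⟨i, rfl⟩⟩ : DiffAlg n))

theorem diffOp_X (n : ℕ) (i : Fin (n + 1)) (f : Poly n) :
    diffOp n (MvPolynomial.X i) f = MvPolynomial.pderiv i f := by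
  simp [diffOp, partialD]

/-- The annihilator ideal `Ann(f) = {α ∈ Q | α(f) = 0}`. -/
def Ann {n : ℕ} (f : Poly n) : Ideal (Poly n) where
  carrier := {α | diffOp n α f = 0}
  zero_mem' := by simp
  add_mem' := by
    intro a b ha hb
    simp_all
  smul_mem' := by
    intro c a ha
    simp_all

/-- The algebra `A(f) = Q / Ann(f)`. -/
abbrev A {n : ℕ} (f : Poly n) : Type := Poly n ⧸ Ann f

/-- The graded piece `A(f)_k`: the image of `Q_k` in `A(f)`. -/
def gradedPiece {n : ℕ} (f : Poly n) (k : ℕ) : Submodule ℂ (A f) :=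
  (Form n k).map (Ideal.Quotient.mkₐ ℂ (Ann f)).toLinearMap

/-- `h_k(A(f)) = dim A(f)_k`. -/
def h {n : ℕ} (k : ℕ) (f : Poly n) : ℕ := Module.finrank ℂ (gradedPiece f k)

/-- The Hilbert vector `(h_0(A(f)), …, h_d(A(f)))` of a form `f` of degree `d`. -/
def hilb {n d : ℕ} (f : Form n d) : Fin (d + 1) → ℕ := fun k => h k (f : Poly n)

/-- `U` is Zariski open in the affine space `R_d`: its complement is the set of common zeros of a
family of polynomials in the coefficients of a form of degree `d`. -/
def IsZariskiOpen {n d : ℕ} (U : Set (Form n d)) : Prop :=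
  ∃ S : Set (MvPolynomial {m : Fin (n + 1) →₀ ℕ // m.degree = d} ℂ),
    Uᶜ = {f : Form n d | ∀ P ∈ S, MvPolynomial.eval (fun m => (f : Poly n).coeff m.1) P = 0}

/-- The defining property of the set `U'_d`: a nonempty Zariski open subset of `R_d` on which the
Hilbert vector of `A(f)` is constant. -/
structure IsHilbertOpen {n d : ℕ} (U : Set (Form n d)) : Prop where
  isOpen : IsZariskiOpen U
  nonempty : U.Nonempty
  constant : ∀ f ∈ U, ∀ g ∈ U, hilb f = hilb g

/-- The Fermat polynomial `x₀^d + ⋯ + xₙ^d`. -/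
def fermat (n d : ℕ) : Form n d :=
  ⟨∑ i : Fin (n + 1), MvPolynomial.X i ^ d,
    Submodule.sum_mem _ fun i _ => MvPolynomial.isHomogeneous_X_pow i d⟩

end MacaulayDual

end

/-!
The dimension `h_k(A(f))` is the rank of the catalecticant map `Q_k → R`, `α ↦ α(f)`. For `f` of
degree `d`, Euler's identity shows that this is also the rank of the pairing `(α, β) ↦ (αβ)(f)` on
`Q_k × Q_{d-k}`, so the Hilbert vector is symmetric. An element of `Q_k` killing `f` yields, after
multiplication by a power of `X_0`, elements of every higher degree killing `f`; hence the Hilbert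
vector is maximal as soon as the catalecticant of degree `⌊d/2⌋` is injective, which is a Zariski
open condition on `f`.

This condition is satisfied by `f = ∑ₚ (p_0 x_0 + ⋯ + p_n x_n)^d`, with `p` in a sufficiently large
finite grid of points with positive real coordinates: if `α ∈ Q_k` kills `f` and `2k ≤ d`, applying
`X_0^(d-2k) · ᾱ` to `α(f) = 0` gives `d! ∑ₚ p_0^(d-2k) |α(p)|² = 0`, so `α` vanishes on the grid.

Since two nonempty Zariski open sets meet, the Hilbert vector on any `U'_d` is this maximal one. The
Fermat polynomial is killed by `X_i X_j` for `i ≠ j`, so its catalecticant of degree `2` is not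
injective.
-/

noncomputable section

namespace MacaulayDual

open MvPolynomial

section LinearAlgebra

variable {K V W W' : Type*} [Field K] [AddCommGroup V] [Module K V] [AddCommGroup W] [Module K W]
  [AddCommGroup W'] [Module K W']

theorem finrank_range_eq_of_ker_eq {φ : V →ₗ[K] W} {ψ : V →ₗ[K] W'}
    (hker : LinearMap.ker φ = LinearMap.ker ψ) :
    Module.finrank K (LinearMap.range φ) = Module.finrank K (LinearMap.range ψ) :=
  (φ.quotKerEquivRange.symm ≪≫ₗ Submodule.quotEquivOfEq _ _ hker ≪≫ₗ
    ψ.quotKerEquivRange).finrank_eq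

theorem finrank_range_eq_finrank_iff_injective [FiniteDimensional K V] {φ : V →ₗ[K] W} :
    Module.finrank K (LinearMap.range φ) = Module.finrank K V ↔ Function.Injective φ := by
  rw [← LinearMap.ker_eq_bot, ← Submodule.finrank_eq_zero (R := K),
    ← φ.finrank_range_add_finrank_ker, left_eq_add]

theorem finrank_range_flip [FiniteDimensional K V] [FiniteDimensional K W]
    (B : V →ₗ[K] W →ₗ[K] K) :
    Module.finrank K (LinearMap.range B.flip) = Module.finrank K (LinearMap.range B) := by
  have hflip : B.flip = B.dualMap ∘ₗ (Module.evalEquiv K W).toLinearMap := by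
    ext
    simp
  rw [← B.finrank_range_dualMap_eq_finrank_range, hflip,
    LinearMap.range_comp_of_range_eq_top _ (LinearEquiv.range _)]

theorem injective_iff_exists_det_comp_ne_zero [FiniteDimensional K V] {φ : V →ₗ[K] W} :
    Function.Injective φ ↔ ∃ ψ : W →ₗ[K] V, LinearMap.det (ψ ∘ₗ φ) ≠ 0 := by
  constructor
  · intro hφ
    obtain ⟨ψ, hψ⟩ := φ.exists_leftInverse_of_injective (LinearMap.ker_eq_bot.2 hφ)
    exact ⟨ψ, by simp [hψ]⟩
  · rintro ⟨ψ, hψ⟩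
    have hcomp : Function.Injective (ψ ∘ₗ φ) :=
      ((LinearMap.isUnit_iff_isUnit_det _).2 hψ.isUnit |> (Module.End.isUnit_iff _).1).injective
    exact Function.Injective.of_comp hcomp

end LinearAlgebra

section HomogeneousPolynomials

variable (σ R : Type*) [CommSemiring R]

/-- The basis of monomials of degree `d`, whose coordinates are the coefficients. -/
def homogeneousBasis (d : ℕ) :
    Module.Basis {m : σ →₀ ℕ // m.degree = d} R (homogeneousSubmodule σ R d) :=
  (basisRestrictSupport R {m : σ →₀ ℕ | m.degree = d}).map
    (LinearEquiv.ofEq _ _ (homogeneousSubmodule_eq_finsupp_supported σ R d).symm)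

variable {σ R}

theorem finrank_homogeneousSubmodule [Fintype σ] [StrongRankCondition R] (d : ℕ) :
    Module.finrank R (homogeneousSubmodule σ R d) = (Fintype.card σ + d - 1).choose d := by
  classical
  have hmem (m : σ →₀ ℕ) : m ∈ Finset.finsuppAntidiag Finset.univ d ↔ m.degree = d := by
    simp [Finset.mem_finsuppAntidiag, Finsupp.degree_eq_sum]
  rw [Module.finrank_eq_nat_card_basis (homogeneousBasis σ R d), Nat.subtype_card _ hmem,
    Finset.card_finsuppAntidiag_nat_eq_choose, Finset.card_univ]

@[elab_as_elim]
theorem isHomogeneous_induction {P : ℕ → MvPolynomial σ R → Prop} {k : ℕ} {p : MvPolynomial σ R}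
    (hp : p.IsHomogeneous k) (zero : ∀ k, P k 0) (one : P 0 1)
    (add : ∀ k p q, P k p → P k q → P k (p + q)) (smul : ∀ k (r : R) p, P k p → P k (r • p))
    (X_mul : ∀ k i p, P k p → P (k + 1) (X i * p)) : P k p := by
  let S (k : ℕ) : Submodule R (MvPolynomial σ R) :=
    { carrier := {p | P k p}
      zero_mem' := zero k
      add_mem' := add k _ _
      smul_mem' := fun r p => smul k r p }
  suffices hS : ∀ k, homogeneousSubmodule σ R k ≤ S k from hS k hp
  intro k
  induction k with
  | zero => exact homogeneousSubmodule_zero (σ := σ) (R := R) ▸ Submodule.one_le.2 one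
  | succ k ih =>
    rw [← homogeneousSubmodule_one_pow, pow_succ', homogeneousSubmodule_one_pow,
      homogeneousSubmodule_one_eq_span_X, Submodule.mul_le]
    intro q hq p hp
    have hspan : Submodule.span R (Set.range X) ≤ (S (k + 1)).comap (LinearMap.mulRight R p) :=
      Submodule.span_le.2 (Set.range_subset_iff.2 fun i => X_mul k i p (ih hp))
    exact hspan hq

end HomogeneousPolynomials

section ZariskiOpen

variable {n d : ℕ}

theorem IsZariskiOpen.exists_polynomial_ne_zero {U : Set (Form n d)} (hU : IsZariskiOpen U)
    (hne : U.Nonempty) :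
    ∃ P : MvPolynomial {m : Fin (n + 1) →₀ ℕ // m.degree = d} ℂ, P ≠ 0 ∧
      ∀ f : Form n d, eval (fun m => (f : Poly n).coeff m.1) P ≠ 0 → f ∈ U := by
  obtain ⟨S, hS⟩ := hU
  have mem_iff (f : Form n d) :
      f ∈ U ↔ ∃ P ∈ S, eval (fun m => (f : Poly n).coeff m.1) P ≠ 0 := by
    rw [← not_iff_not, ← Set.mem_compl_iff, hS, Set.mem_ofPred_eq]
    push Not
    rfl
  obtain ⟨f, hf⟩ := hne
  obtain ⟨P, hP, hPf⟩ := (mem_iff f).1 hf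
  exact ⟨P, ne_zero_of_map hPf, fun g hg => (mem_iff g).2 ⟨P, hP, hg⟩⟩

theorem IsZariskiOpen.inter_nonempty {U V : Set (Form n d)} (hU : IsZariskiOpen U)
    (hV : IsZariskiOpen V) (hU' : U.Nonempty) (hV' : V.Nonempty) : (U ∩ V).Nonempty := by
  have : Finite {m : Fin (n + 1) →₀ ℕ // m.degree = d} := Finsupp.finite_of_degree_eq d
  obtain ⟨P, hP, hPU⟩ := hU.exists_polynomial_ne_zero hU'
  obtain ⟨Q, hQ, hQV⟩ := hV.exists_polynomial_ne_zero hV'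
  obtain ⟨a, ha⟩ : ∃ a, eval a (P * Q) ≠ 0 := by
    by_contra! hvanish
    exact mul_ne_zero hP hQ (MvPolynomial.funext fun a => by rw [hvanish a, map_zero])
  let f := (homogeneousBasis (Fin (n + 1)) ℂ d).equivFun.symm a
  have hf : (fun m => (f : Poly n).coeff m.1) = a :=
    (homogeneousBasis (Fin (n + 1)) ℂ d).equivFun.apply_symm_apply a
  rw [← hf, map_mul] at ha
  exact ⟨f, hPU f (left_ne_zero_of_mul ha), hQV f (right_ne_zero_of_mul ha)⟩

theorem isZariskiOpen_setOf_injective {V W : Type*} [AddCommGroup V] [Module ℂ V]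
    [FiniteDimensional ℂ V] [AddCommGroup W] [Module ℂ W] (Φ : Form n d →ₗ[ℂ] V →ₗ[ℂ] W) :
    IsZariskiOpen {f | Function.Injective (Φ f)} := by
  -- Injectivity at `f` means `det (ψ ∘ Φ f) ≠ 0` for some `ψ`, and this is polynomial in `f`.
  classical
  have : Fintype {m : Fin (n + 1) →₀ ℕ // m.degree = d} :=
    (Finsupp.finite_of_degree_eq d).fintype
  let b := homogeneousBasis (Fin (n + 1)) ℂ d
  let family (ψ : W →ₗ[ℂ] V) : Form n d →ₗ[ℂ] Module.End ℂ V := LinearMap.llcomp ℂ V W V ψ ∘ₗ Φ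
  have eval_eq_zero_iff (ψ : W →ₗ[ℂ] V) (f : Form n d) :
      eval (fun m => (f : Poly n).coeff m.1) (((family ψ).polyCharpoly b).coeff 0) = 0 ↔
        LinearMap.det (ψ ∘ₗ Φ f) = 0 := by
    have heval : eval (fun m => (f : Poly n).coeff m.1) (((family ψ).polyCharpoly b).coeff 0) =
        (ψ ∘ₗ Φ f).charpoly.coeff 0 := (family ψ).polyCharpoly_coeff_eval b f 0
    simp [heval, LinearMap.det_eq_sign_charpoly_coeff]
  refine ⟨Set.range fun ψ => ((family ψ).polyCharpoly b).coeff 0, ?_⟩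
  ext f
  simp only [Set.mem_compl_iff, Set.mem_ofPred_eq, injective_iff_exists_det_comp_ne_zero,
    Set.forall_mem_range, eval_eq_zero_iff, not_exists, not_not]

end ZariskiOpen

section Apolarity

variable {n d k : ℕ}

theorem diffOp_mul_apply (α β f : Poly n) :
    diffOp n (α * β) f = diffOp n α (diffOp n β f) := by
  rw [map_mul, Module.End.mul_apply]

theorem isHomogeneous_diffOp {α f : Poly n} (hα : α.IsHomogeneous k) (hf : f.IsHomogeneous d) :
    (diffOp n α f).IsHomogeneous (d - k) := by
  refine isHomogeneous_induction hα ?zero ?one ?add ?smul ?X_mul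
  case zero =>
    intro k
    simpa using isHomogeneous_zero _ _ _
  case one => simpa using hf
  case add =>
    intro k α β hα hβ
    simpa using hα.add hβ
  case smul =>
    intro k c α hα
    simpa using (Form n (d - k)).smul_mem c hα
  case X_mul =>
    intro k i α hα
    rw [diffOp_mul_apply, diffOp_X, ← Nat.sub_sub]
    exact hα.pderiv

theorem eq_zero_of_forall_coeff_diffOp_eq_zero {g : Poly n} (hg : g.IsHomogeneous d)
    (hzero : ∀ β : Form n d, coeff 0 (diffOp n β g) = 0) : g = 0 := by
  induction d generalizing g with
  | zero =>
    have hcoeff : coeff 0 g = 0 := by simpa using hzero ⟨1, isHomogeneous_one _ _⟩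
    rw [← homogeneousComponent_eq_self hg, homogeneousComponent_zero, hcoeff, C_0]
  | succ d ih =>
    have hderiv (i : Fin (n + 1)) : pderiv i g = 0 := ih hg.pderiv fun β => by
      rw [← diffOp_X, ← diffOp_mul_apply]
      exact hzero ⟨(β : Poly n) * X i, IsHomogeneous.mul β.2 (isHomogeneous_X ℂ i)⟩
    have heuler : (d + 1) • g = 0 := by simp [← hg.sum_X_mul_pderiv, hderiv]
    exact (smul_eq_zero.1 heuler).resolve_left d.succ_ne_zero

/-- The catalecticant map `α ↦ α(f)` of `f` on the forms of degree `k`, linear also in `f`. -/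
def catalecticant (n k : ℕ) : Poly n →ₗ[ℂ] Form n k →ₗ[ℂ] Poly n :=
  ((diffOp n).toLinearMap.domRestrict (Form n k)).flip

theorem catalecticant_apply (f : Poly n) (α : Form n k) :
    catalecticant n k f α = diffOp n α f :=
  rfl

instance finiteDimensional_form (n k : ℕ) : FiniteDimensional ℂ (Form n k) :=
  Module.Finite.iff_fg.2 (homogeneousSubmodule_fg _ _ k)

theorem h_eq_finrank_range_catalecticant (k : ℕ) (f : Poly n) :
    h k f = Module.finrank ℂ (LinearMap.range (catalecticant n k f)) := by
  let toQuotient : Form n k →ₗ[ℂ] A f :=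
    (Ideal.Quotient.mkₐ ℂ (Ann f)).toLinearMap ∘ₗ (Form n k).subtype
  have hrange : LinearMap.range toQuotient = gradedPiece f k := by
    rw [LinearMap.range_comp, Submodule.range_subtype, gradedPiece]
  have hker : LinearMap.ker toQuotient = LinearMap.ker (catalecticant n k f) := by
    ext α
    exact Ideal.Quotient.eq_zero_iff_mem
  rw [h, ← hrange, finrank_range_eq_of_ker_eq hker]

theorem h_eq_finrank_iff {f : Poly n} :
    h k f = Module.finrank ℂ (Form n k) ↔ Function.Injective (catalecticant n k f) := by
  rw [h_eq_finrank_range_catalecticant, finrank_range_eq_finrank_iff_injective]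

/-- The apolarity pairing `(α, β) ↦ (αβ)(f)` of `Q_k` and `Q_l`. It is meant for `k + l = deg f`,
where `(αβ)(f)` is a constant; taking its constant coefficient makes it total. -/
def apolarPairing (f : Poly n) (k l : ℕ) : Form n k →ₗ[ℂ] Form n l →ₗ[ℂ] ℂ :=
  LinearMap.mk₂ ℂ (fun α β => coeff 0 (diffOp n (α * β) f))
    (by simp [add_mul]) (by simp) (by simp [mul_add]) (by simp)

theorem apolarPairing_flip (f : Poly n) (k l : ℕ) :
    (apolarPairing f k l).flip = apolarPairing f l k := by
  ext α β
  simp only [apolarPairing, LinearMap.flip_apply, LinearMap.mk₂_apply, mul_comm]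

theorem ker_apolarPairing {f : Poly n} (hf : f.IsHomogeneous d) (k : ℕ) :
    LinearMap.ker (apolarPairing f k (d - k)) = LinearMap.ker (catalecticant n k f) := by
  ext α
  have hpair (β : Form n (d - k)) :
      apolarPairing f k (d - k) α β = coeff 0 (diffOp n β (diffOp n α f)) := by
    rw [← diffOp_mul_apply, mul_comm]
    rfl
  simp only [LinearMap.mem_ker, LinearMap.ext_iff, hpair, catalecticant_apply,
    LinearMap.zero_apply]
  exact ⟨eq_zero_of_forall_coeff_diffOp_eq_zero (isHomogeneous_diffOp α.2 hf),
    fun hα β => by rw [hα, map_zero, coeff_zero]⟩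

theorem h_symm {f : Poly n} (hf : f.IsHomogeneous d) (hk : k ≤ d) : h k f = h (d - k) f := by
  have h_eq_rank (l : ℕ) :
      h l f = Module.finrank ℂ (LinearMap.range (apolarPairing f l (d - l))) := by
    rw [h_eq_finrank_range_catalecticant, finrank_range_eq_of_ker_eq (ker_apolarPairing hf l)]
  rw [h_eq_rank, h_eq_rank, Nat.sub_sub_self hk, ← apolarPairing_flip, finrank_range_flip]

theorem finrank_form (n k : ℕ) : Module.finrank ℂ (Form n k) = (n + k).choose n := by
  rw [finrank_homogeneousSubmodule, Fintype.card_fin, Nat.add_right_comm, Nat.add_sub_cancel,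
    Nat.choose_symm_add]

theorem catalecticant_injective_of_le {l : ℕ} {f : Poly n} (hkl : k ≤ l)
    (hf : Function.Injective (catalecticant n l f)) :
    Function.Injective (catalecticant n k f) := by
  rw [injective_iff_map_eq_zero] at hf ⊢
  intro α hα
  let β : Form n l := ⟨X 0 ^ (l - k) * (α : Poly n), by
    simpa [Nat.sub_add_cancel hkl] using (isHomogeneous_X_pow (0 : Fin (n + 1)) (l - k)).mul α.2⟩
  have hβ : β = 0 := hf β <| by
    rw [catalecticant_apply, diffOp_mul_apply, ← catalecticant_apply, hα, map_zero]
  have hmul : X 0 ^ (l - k) * (α : Poly n) = 0 := congrArg Subtype.val hβ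
  exact Subtype.ext ((mul_eq_zero.1 hmul).resolve_left (pow_ne_zero _ (X_ne_zero 0)))

end Apolarity

section PowersOfLinearForms

variable {n d k : ℕ}

/-- The linear form `p_0 x_0 + ⋯ + p_n x_n` attached to the point `p`. -/
def linearForm (p : Fin (n + 1) → ℂ) : Form n 1 :=
  ⟨∑ i, C (p i) * X i, IsHomogeneous.sum _ _ _ fun i _ => isHomogeneous_C_mul_X (p i) i⟩

theorem pderiv_linearForm (p : Fin (n + 1) → ℂ) (i : Fin (n + 1)) :
    pderiv i (linearForm p : Poly n) = C (p i) := by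
  simp [linearForm, pderiv_X, Pi.single_apply]

theorem diffOp_linearForm_pow (p : Fin (n + 1) → ℂ) {α : Poly n} (hα : α.IsHomogeneous k) :
    diffOp n α ((linearForm p : Poly n) ^ d) =
      (d.descFactorial k * eval p α : ℂ) • (linearForm p : Poly n) ^ (d - k) := by
  refine isHomogeneous_induction hα ?zero ?one ?add ?smul ?X_mul
  case zero => simp
  case one => simp
  case add =>
    intro k α β hα hβ
    simp [hα, hβ, mul_add, add_smul]
  case smul =>
    intro k c α hα
    simp [hα, smul_smul, smul_eval, mul_left_comm]
  case X_mul =>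
    intro k i α hα
    rw [diffOp_mul_apply, hα, map_smul, diffOp_X, pderiv_pow, pderiv_linearForm, Nat.sub_sub,
      map_mul, eval_X, Nat.descFactorial_succ]
    simp only [smul_eq_C_mul, map_mul, map_natCast, Nat.cast_mul]
    ring

theorem diffOp_sum_linearForm_pow {ι : Type*} (s : Finset ι) (p : ι → Fin (n + 1) → ℂ)
    {α : Poly n} (hα : α.IsHomogeneous d) :
    diffOp n α (∑ a ∈ s, (linearForm (p a) : Poly n) ^ d) =
      C (d.factorial * ∑ a ∈ s, eval (p a) α) := by
  simp [diffOp_linearForm_pow _ hα, Nat.descFactorial_self, smul_eq_C_mul, Finset.mul_sum]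

/-- The grid `{1, …, d + 1}^(n + 1)`: enough points to detect every nonzero polynomial of degree at
most `d`, all of them with positive real coordinates. -/
def grid (n d : ℕ) : Finset (Fin (n + 1) → ℕ) :=
  Fintype.piFinset fun _ => Finset.Icc 1 (d + 1)

theorem eq_zero_of_eval_grid_eq_zero {α : Poly n} (hα : α.totalDegree ≤ d)
    (heval : ∀ p ∈ grid n d, eval (fun i => (p i : ℂ)) α = 0) : α = 0 := by
  refine eq_zero_of_eval_zero_at_prod_finset α
    (fun _ => (Finset.Icc 1 (d + 1)).map Nat.castEmbedding) (fun i => ?_) fun x hx => ?_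
  · simpa [Nat.lt_succ_iff] using (degreeOf_le_totalDegree α i).trans hα
  · choose p hp hpx using fun i => Finset.mem_map.1 (hx i)
    obtain rfl : (fun i => (p i : ℂ)) = x := _root_.funext hpx
    exact heval p (Fintype.mem_piFinset.2 hp)

theorem eval_natCast_map_conj {σ : Type*} (p : σ → ℕ) (α : MvPolynomial σ ℂ) :
    eval (fun i => (p i : ℂ)) (map (starRingEnd ℂ) α) =
      starRingEnd ℂ (eval (fun i => (p i : ℂ)) α) := by
  rw [eval₂_comp, eval_map]
  congr
  simp [Function.comp_def]

/-- The sum of the powers `(p_0 x_0 + ⋯ + p_n x_n)^d` over the points `p` of the grid: an explicit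
form of degree `d` all of whose Hilbert function values are as large as possible. -/
def gridForm (n d : ℕ) : Form n d :=
  ⟨∑ p ∈ grid n d, (linearForm fun i => (p i : ℂ) : Poly n) ^ d,
    IsHomogeneous.sum _ _ _ fun p _ => by
      simpa using (linearForm fun i => (p i : ℂ)).2.pow d⟩

theorem catalecticant_gridForm_injective (hk : 2 * k ≤ d) :
    Function.Injective (catalecticant n k (gridForm n d)) := by
  rw [injective_iff_map_eq_zero]
  intro α hα
  have hαk : (α : Poly n).IsHomogeneous k := α.2
  let β : Poly n := X 0 ^ (d - 2 * k) * map (starRingEnd ℂ) α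
  have hβα : (β * α).IsHomogeneous d := by
    convert ((isHomogeneous_X_pow 0 (d - 2 * k)).mul (hαk.map _)).mul hαk using 1
    omega
  have hsum : ∑ p ∈ grid n d, eval (fun i => (p i : ℂ)) (β * α) = 0 := by
    have hkill : diffOp n (β * α) (gridForm n d) = 0 := by
      rw [diffOp_mul_apply, ← catalecticant_apply, hα, map_zero]
    rw [gridForm, diffOp_sum_linearForm_pow _ _ hβα, C_eq_zero] at hkill
    exact (mul_eq_zero.1 hkill).resolve_left (Nat.cast_ne_zero.2 d.factorial_ne_zero)
  have hterm (p : Fin (n + 1) → ℕ) : eval (fun i => (p i : ℂ)) (β * α) =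
      ((p 0 ^ (d - 2 * k) * Complex.normSq (eval (fun i => (p i : ℂ)) α) : ℝ) : ℂ) := by
    simp only [β, map_mul, map_pow, eval_X, eval_natCast_map_conj, mul_assoc,
      ← Complex.normSq_eq_conj_mul_self]
    push_cast
    rfl
  simp only [hterm, ← Complex.ofReal_sum, Complex.ofReal_eq_zero] at hsum
  rw [Finset.sum_eq_zero_iff_of_nonneg fun p _ =>
    mul_nonneg (by positivity) (Complex.normSq_nonneg _)] at hsum
  refine Subtype.ext (eq_zero_of_eval_grid_eq_zero (d := d) (hαk.totalDegree_le.trans (by omega))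
    fun p hp => ?_)
  have hp0 : 1 ≤ p 0 := (Finset.mem_Icc.1 (Fintype.mem_piFinset.1 hp 0)).1
  exact Complex.normSq_eq_zero.1 ((mul_eq_zero.1 (hsum p hp)).resolve_left (by positivity))

end PowersOfLinearForms

section CompressedForms

variable {n d k : ℕ}

/-- The compressed forms, those for which every `A(f)_k` is as large as possible. Only the middle
catalecticant is required to be injective, since injectivity passes to smaller degrees and the
larger degrees are controlled by the symmetry of the Hilbert vector. -/
def compressedForms (n d : ℕ) : Set (Form n d) :=
  {f | Function.Injective (catalecticant n (d / 2) f)}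

theorem isZariskiOpen_compressedForms (n d : ℕ) : IsZariskiOpen (compressedForms n d) :=
  isZariskiOpen_setOf_injective (catalecticant n (d / 2) ∘ₗ (Form n d).subtype)

theorem compressedForms_nonempty (n d : ℕ) : (compressedForms n d).Nonempty :=
  ⟨gridForm n d, catalecticant_gridForm_injective (Nat.mul_div_le d 2)⟩

theorem h_eq_finrank_of_mem_compressedForms {f : Form n d} (hf : f ∈ compressedForms n d)
    (hk : 2 * k ≤ d) : h k (f : Poly n) = Module.finrank ℂ (Form n k) :=
  h_eq_finrank_iff.2 (catalecticant_injective_of_le (by omega) hf)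

theorem isHilbertOpen_compressedForms (n d : ℕ) : IsHilbertOpen (compressedForms n d) where
  isOpen := isZariskiOpen_compressedForms n d
  nonempty := compressedForms_nonempty n d
  constant f hf g hg := by
    ext ⟨k, hk⟩
    have hkd : k ≤ d := Nat.lt_succ_iff.1 hk
    change h k (f : Poly n) = h k (g : Poly n)
    rcases le_total (2 * k) d with hlow | hhigh
    · rw [h_eq_finrank_of_mem_compressedForms hf hlow, h_eq_finrank_of_mem_compressedForms hg hlow]
    · have hdual : 2 * (d - k) ≤ d := by omega
      rw [h_symm f.2 hkd, h_symm g.2 hkd, h_eq_finrank_of_mem_compressedForms hf hdual,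
        h_eq_finrank_of_mem_compressedForms hg hdual]

theorem IsHilbertOpen.subset_compressedForms {U : Set (Form n d)} (hU : IsHilbertOpen U) :
    U ⊆ compressedForms n d := by
  intro f hf
  obtain ⟨g, hgU, hg⟩ := hU.isOpen.inter_nonempty (isZariskiOpen_compressedForms n d) hU.nonempty
    (compressedForms_nonempty n d)
  have hfg : h (d / 2) (f : Poly n) = h (d / 2) (g : Poly n) :=
    congrFun (hU.constant f hf g hgU) ⟨d / 2, by omega⟩
  exact h_eq_finrank_iff.1 (hfg.trans (h_eq_finrank_iff.2 hg))

theorem diffOp_X_mul_X_fermat {i j : Fin (n + 1)} (hij : i ≠ j) :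
    diffOp n (X i * X j) (fermat n d) = 0 := by
  have hderiv : pderiv j (fermat n d : Poly n) = C (d : ℂ) * X j ^ (d - 1) := by
    simp [fermat, pderiv_X, Pi.single_apply]
  rw [diffOp_mul_apply, diffOp_X, diffOp_X, hderiv, pderiv_C_mul, pderiv_pow,
    pderiv_X_of_ne hij.symm, mul_zero, mul_zero]

theorem fermat_notMem_compressedForms (hn : 1 ≤ n) (hd : 4 ≤ d) :
    fermat n d ∉ compressedForms n d := by
  intro hf
  have : Nontrivial (Fin (n + 1)) := Fin.nontrivial_iff_two_le.2 (by omega)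
  obtain ⟨i, j, hij⟩ := exists_pair_ne (Fin (n + 1))
  let α : Form n 2 := ⟨X i * X j, (isHomogeneous_X ℂ i).mul (isHomogeneous_X ℂ j)⟩
  have hinj : Function.Injective (catalecticant n 2 (fermat n d)) :=
    catalecticant_injective_of_le (by omega) hf
  have hα : α = 0 := (injective_iff_map_eq_zero _).1 hinj α (diffOp_X_mul_X_fermat hij)
  exact mul_ne_zero (X_ne_zero i) (X_ne_zero j) (congrArg Subtype.val hα)

end CompressedForms

end MacaulayDual

end

theorem proposition3p3 (n d : ℕ) (hd : 1 ≤ d) :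
    (∃ U : Set (MacaulayDual.Form n d), MacaulayDual.IsHilbertOpen U) ∧
    ∀ U : Set (MacaulayDual.Form n d), MacaulayDual.IsHilbertOpen U →
      (∀ f ∈ U,
        (∀ k : ℕ, 2 * k ≤ d →
          MacaulayDual.h k (f : MacaulayDual.Poly n) =
              Module.finrank ℂ (MacaulayDual.Form n k) ∧
          Module.finrank ℂ (MacaulayDual.Form n k) = (n + k).choose n) ∧
        (∀ k : ℕ, d < 2 * k → k ≤ d →
          MacaulayDual.h k (f : MacaulayDual.Poly n) =
              MacaulayDual.h (d - k) (f : MacaulayDual.Poly n) ∧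
          MacaulayDual.h (d - k) (f : MacaulayDual.Poly n) = (n + (d - k)).choose n)) ∧
      (1 ≤ n → 4 ≤ d → MacaulayDual.fermat n d ∉ U) := by
  refine ⟨⟨_, MacaulayDual.isHilbertOpen_compressedForms n d⟩,
    fun U hU => ⟨fun f hf => ⟨?_, ?_⟩, ?_⟩⟩
  · intro k hk
    exact ⟨MacaulayDual.h_eq_finrank_of_mem_compressedForms (hU.subset_compressedForms hf) hk,
      MacaulayDual.finrank_form n k⟩
  · intro k hk hkd
    have hdual : 2 * (d - k) ≤ d := by omega
    exact ⟨MacaulayDual.h_symm f.2 hkd,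
      (MacaulayDual.h_eq_finrank_of_mem_compressedForms (hU.subset_compressedForms hf) hdual).trans
        (MacaulayDual.finrank_form n (d - k))⟩
  · exact fun hn hd hfermat =>
      MacaulayDual.fermat_notMem_compressedForms hn hd (hU.subset_compressedForms hfermat)
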